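/- Let $\alpha<\beta$ be infinite ordinals (an ordinal being identified with the set of smaller ordinals). A polyadic algebra of dimension $\alpha$ (a $\mathsf{PA}_\alpha$) is a Boolean algebra $\mathfrak A$ with operations ${\sf c}_{(\Gamma)}$ ($\Gamma\subseteq\alpha$) and ${\sf s}_\tau$ ($\tau:\alpha\to\alpha$) such that for all $\Gamma,\Delta\subseteq\alpha$, $\sigma,\tau:\alpha\to\alpha$ and all elements $x,y$: ${\sf c}_{(\Gamma)}0=0$; $x\le{\sf c}_{(\Gamma)}x$; ${\sf c}_{(\Gamma)}(x\cdot{\sf c}_{(\Gamma)}y)={\sf c}_{(\Gamma)}x\cdot{\sf c}_{(\Gamma)}y$; ${\sf c}_{(\emptyset)}x=x$; ${\sf c}_{(\Gamma)}{\sf c}_{(\Delta)}x={\sf c}_{(\Gamma\cup\Delta)}x$; ${\sf s}_\tau$ is a Boolean endomorphism; ${\sf s}_{\mathrm{Id}}x=x$; ${\sf s}_{\sigma\circ\tau}x={\sf s}_\sigma{\sf s}_\tau x$; if $\sigma$ and $\tau$ agree on $\alpha\smallsetminus\Gamma$, then ${\sf s}_\sigma{\sf c}_{(\Gamma)}x={\sf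 s}_\tau{\sf c}_{(\Gamma)}x$; if $\tau$ is one-to-one on $\tau^{-1}\Gamma$, then ${\sf c}_{(\Gamma)}{\sf s}_\tau x={\sf s}_\tau{\sf c}_{(\tau^{-1}\Gamma)}x$. Homomorphisms preserve all these operations, an embedding is an injective homomorphism, and an isomorphism is a bijective one. For $\mathfrak B\in\mathsf{PA}_\beta$, the neat reduct $\mathfrak{Nr}_\alpha\mathfrak B\in\mathsf{PA}_\alpha$ has universe $\{x\in B:{\sf c}_{(\beta\smallsetminus\alpha)}x=x\}$, the Boolean operations of $\mathfrak B$, the operations ${\sf c}_{(\Gamma)}$ of $\mathfrak B$ for $\Gamma\subseteq\alpha$, and, for $\tau:\alpha\to\alpha$, the operation ${\sf s}_{\bar\tau}$ of $\mathfrak B$, where $\bar\tau$ extends $\tau$ by the identity on $\beta\smallsetminus\alpha$. $\mathfrak{Sg}^{\mathfrak B}X$ denotes the subalgebra of $\mathfrak B$ (under all $\mathsf{PA}_\beta$ operations) generated by $X$. Theorem. Let $\mathfrak A,\mathfrak A'\in\mathsf{PA}_\alpha$ and $\mathfrak B,\mathfrak B'\in\mathsf{PA}_\beta$. (1) If $e:\mathfrak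 A\to\mathfrak{Nr}_\alpha\mathfrak B$ and $e':\mathfrak A\to\mathfrak{Nr}_\alpha\mathfrak B'$ are embeddings with $\mathfrak{Sg}^{\mathfrak B}e(A)=\mathfrak B$ and $\mathfrak{Sg}^{\mathfrak B'}e'(A)=\mathfrak B'$, then there is an isomorphism $h:\mathfrak B\to\mathfrak B'$ with $h\circ e=e'$; that is, $\mathfrak B$ and $\mathfrak B'$ are isomorphic by an isomorphism that fixes $\mathfrak A$ pointwise. (2) More generally, if $e_A:\mathfrak A\to\mathfrak{Nr}_\alpha\mathfrak B$ and $e_{A'}:\mathfrak A'\to\mathfrak{Nr}_\alpha\mathfrak B'$ are embeddings with $\mathfrak{Sg}^{\mathfrak B}e_A(A)=\mathfrak B$ and $\mathfrak{Sg}^{\mathfrak B'}e_{A'}(A')=\mathfrak B'$, and $i:\mathfrak A\to\mathfrak A'$ is an isomorphism, then there is an isomorphism $\bar{i}:\mathfrak B\to\mathfrak B'$ with $\bar{i}\circ e_A=e_{A'}\circ i$. -/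

import Mathlib

/-- Polyadic algebras (without diagonal elements) whose set of dimensions is `I`: Boolean algebras
with a cylindrification `cyl Γ` for every set `Γ ⊆ I` of dimensions and a substitution `subst τ`
for every transformation `τ : I → I`. -/
class PolyadicAlgebra (I : Type*) (A : Type*) [BooleanAlgebra A] where
  cyl : Set I → A → A
  subst : (I → I) → A → A
  cyl_bot : ∀ Γ : Set I, cyl Γ ⊥ = ⊥
  le_cyl : ∀ (Γ : Set I) (x : A), x ≤ cyl Γ x
  cyl_inf_cyl : ∀ (Γ : Set I) (x y : A), cyl Γ (x ⊓ cyl Γ y) = cyl Γ x ⊓ cyl Γ y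
  cyl_empty : ∀ x : A, cyl ∅ x = x
  cyl_cyl : ∀ (Γ Δ : Set I) (x : A), cyl Γ (cyl Δ x) = cyl (Γ ∪ Δ) x
  subst_sup : ∀ (τ : I → I) (x y : A), subst τ (x ⊔ y) = subst τ x ⊔ subst τ y
  subst_compl : ∀ (τ : I → I) (x : A), subst τ xᶜ = (subst τ x)ᶜ
  subst_id : ∀ x : A, subst id x = x
  subst_comp : ∀ (σ τ : I → I) (x : A), subst (σ ∘ τ) x = subst σ (subst τ x)
  subst_cyl_congr : ∀ (σ τ : I → I) (Γ : Set I) (x : A), (∀ i, i ∉ Γ → σ i = τ i) →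
    subst σ (cyl Γ x) = subst τ (cyl Γ x)
  cyl_subst : ∀ (τ : I → I) (Γ : Set I) (x : A), Set.InjOn τ (τ ⁻¹' Γ) →
    cyl Γ (subst τ x) = subst τ (cyl (τ ⁻¹' Γ) x)

/-- Homomorphisms of polyadic algebras: Boolean homomorphisms commuting with all
cylindrifications and all substitutions. -/
structure PolyadicHom (I : Type*) (A B : Type*) [BooleanAlgebra A] [BooleanAlgebra B]
    [PolyadicAlgebra I A] [PolyadicAlgebra I B] extends BoundedLatticeHom A B where
  map_cyl' : ∀ (Γ : Set I) (x : A),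
    toFun (PolyadicAlgebra.cyl Γ x) = PolyadicAlgebra.cyl Γ (toFun x)
  map_subst' : ∀ (τ : I → I) (x : A),
    toFun (PolyadicAlgebra.subst τ x) = PolyadicAlgebra.subst τ (toFun x)

instance PolyadicHom.instCoeFun (I : Type*) (A B : Type*) [BooleanAlgebra A] [BooleanAlgebra B]
    [PolyadicAlgebra I A] [PolyadicAlgebra I B] :
    CoeFun (PolyadicHom I A B) (fun _ => A → B) :=
  ⟨fun f => f.toFun⟩

namespace PolyadicAlgebra

/-- `S` is the universe of a subalgebra of the polyadic algebra `A`. -/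
structure IsSubuniverse (I : Type*) {A : Type*} [BooleanAlgebra A] [PolyadicAlgebra I A]
    (S : Set A) : Prop where
  bot_mem : ⊥ ∈ S
  top_mem : ⊤ ∈ S
  sup_mem : ∀ x ∈ S, ∀ y ∈ S, x ⊔ y ∈ S
  inf_mem : ∀ x ∈ S, ∀ y ∈ S, x ⊓ y ∈ S
  compl_mem : ∀ x ∈ S, xᶜ ∈ S
  cyl_mem : ∀ (Γ : Set I), ∀ x ∈ S, cyl Γ x ∈ S
  subst_mem : ∀ (τ : I → I), ∀ x ∈ S, subst τ x ∈ S

/-- `Sg I X` is the (universe of the) subalgebra generated by `X`. -/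
def Sg (I : Type*) {A : Type*} [BooleanAlgebra A] [PolyadicAlgebra I A] (X : Set A) : Set A :=
  ⋂₀ {S | IsSubuniverse I S ∧ X ⊆ S}

section Basic

variable {I A : Type*} [BooleanAlgebra A] [PolyadicAlgebra I A]

theorem subst_inf (τ : I → I) (x y : A) : subst τ (x ⊓ y) = subst τ x ⊓ subst τ y := by
  have h : x ⊓ y = (xᶜ ⊔ yᶜ)ᶜ := by simp
  rw [h, subst_compl, subst_sup, subst_compl, subst_compl]
  simp

theorem cyl_self (Γ : Set I) (x : A) : cyl Γ (cyl Γ x) = cyl Γ x := by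
  rw [cyl_cyl, Set.union_self]

theorem cyl_top (Γ : Set I) : cyl Γ (⊤ : A) = ⊤ := top_le_iff.1 (le_cyl Γ ⊤)

theorem cyl_mono (Γ : Set I) {x y : A} (h : x ≤ y) : cyl Γ x ≤ cyl Γ y := by
  have h1 : x ⊓ cyl Γ y = x := inf_eq_left.2 (h.trans (le_cyl Γ y))
  have h2 := cyl_inf_cyl Γ x y
  rw [h1] at h2
  exact inf_eq_left.1 h2.symm

theorem cyl_compl_of_fixed (Γ : Set I) {x : A} (h : cyl Γ x = x) : cyl Γ xᶜ = xᶜ := by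
  refine le_antisymm ?_ (le_cyl Γ _)
  have h1 := cyl_inf_cyl Γ xᶜ x
  rw [h, compl_inf_eq_bot, cyl_bot] at h1
  exact le_compl_iff_disjoint_right.2 (disjoint_iff.2 h1.symm)

theorem cyl_inf_of_fixed (Γ : Set I) {x y : A} (hx : cyl Γ x = x) (hy : cyl Γ y = y) :
    cyl Γ (x ⊓ y) = x ⊓ y := by
  have h := cyl_inf_cyl Γ x y
  rwa [hx, hy] at h

theorem cyl_sup_of_fixed (Γ : Set I) {x y : A} (hx : cyl Γ x = x) (hy : cyl Γ y = y) :
    cyl Γ (x ⊔ y) = x ⊔ y := by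
  have h := cyl_compl_of_fixed Γ
    (cyl_inf_of_fixed Γ (cyl_compl_of_fixed Γ hx) (cyl_compl_of_fixed Γ hy))
  simpa using h

end Basic

section Reduct

variable {I J : Type*} (ι : I ↪ J)

/-- The extension of a transformation of `I` to `J ⊇ I` by the identity outside `I`. -/
noncomputable def extendId (τ : I → I) : J → J := Function.extend ι (ι ∘ τ) id

theorem extendId_apply (τ : I → I) (i : I) : extendId ι τ (ι i) = ι (τ i) :=
  ι.injective.extend_apply _ _ _

theorem extendId_of_notMem (τ : I → I) {j : J} (hj : j ∉ Set.range ι) : extendId ι τ j = j :=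
  Function.extend_apply' _ _ _ hj

theorem extendId_id : extendId ι (id : I → I) = id := by
  funext j
  by_cases hj : j ∈ Set.range ι
  · obtain ⟨i, rfl⟩ := hj
    exact extendId_apply ι _ i
  · exact extendId_of_notMem ι _ hj

theorem extendId_comp (σ τ : I → I) : extendId ι (σ ∘ τ) = extendId ι σ ∘ extendId ι τ := by
  funext j
  by_cases hj : j ∈ Set.range ι
  · obtain ⟨i, rfl⟩ := hj
    simp [extendId_apply]
  · simp [extendId_of_notMem ι _ hj]

theorem extendId_preimage_image (τ : I → I) (Γ : Set I) :
    extendId ι τ ⁻¹' (ι '' Γ) = ι '' (τ ⁻¹' Γ) := by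
  ext j
  by_cases hj : j ∈ Set.range ι
  · obtain ⟨i, rfl⟩ := hj
    simp [extendId_apply]
  · have h : ∀ Δ : Set I, j ∉ ι '' Δ := fun Δ h => hj (Set.image_subset_range ι Δ h)
    simp only [Set.mem_preimage, extendId_of_notMem ι _ hj]
    exact iff_of_false (h _) (h _)

theorem extendId_preimage_compl_range (τ : I → I) :
    extendId ι τ ⁻¹' (Set.range ι)ᶜ = (Set.range ι)ᶜ := by
  ext j
  by_cases hj : j ∈ Set.range ι
  · obtain ⟨i, rfl⟩ := hj
    simp [extendId_apply]
  · simp only [Set.mem_preimage, extendId_of_notMem ι _ hj]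

theorem extendId_injOn_compl_range (τ : I → I) :
    Set.InjOn (extendId ι τ) (extendId ι τ ⁻¹' (Set.range ι)ᶜ) := by
  rw [extendId_preimage_compl_range]
  intro a ha b hb h
  rwa [extendId_of_notMem ι _ ha, extendId_of_notMem ι _ hb] at h

variable (B : Type*) [BooleanAlgebra B] [PolyadicAlgebra J B]

/-- The Boolean part of the neat `I`-reduct of a `J`-dimensional polyadic algebra `B`, where `I`
is identified with a subset of `J` through `ι`: its elements are those `x` which are fixed by the
cylindrification along all the extra dimensions `J ∖ I`. -/
def neatReduct : BooleanSubalgebra B where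
  carrier := {x | cyl (Set.range ι)ᶜ x = x}
  supClosed' := fun _ hx _ hy => cyl_sup_of_fixed _ hx hy
  infClosed' := fun _ hx _ hy => cyl_inf_of_fixed _ hx hy
  compl_mem' := fun hx => cyl_compl_of_fixed _ hx
  bot_mem' := cyl_bot _

variable {B}

theorem mem_neatReduct {x : B} : x ∈ neatReduct ι B ↔ cyl (Set.range ι)ᶜ x = x := Iff.rfl

theorem cyl_mem_neatReduct (Γ : Set J) {x : B} (hx : x ∈ neatReduct ι B) :
    cyl Γ x ∈ neatReduct ι B := by
  rw [mem_neatReduct] at hx ⊢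
  rw [cyl_cyl, Set.union_comm, ← cyl_cyl, hx]

theorem subst_mem_neatReduct (τ : I → I) {x : B} (hx : x ∈ neatReduct ι B) :
    subst (extendId ι τ) x ∈ neatReduct ι B := by
  rw [mem_neatReduct] at hx ⊢
  rw [cyl_subst _ _ _ (extendId_injOn_compl_range ι τ), extendId_preimage_compl_range, hx]

/-- The neat `I`-reduct of a `J`-dimensional polyadic algebra, as an `I`-dimensional polyadic
algebra: its cylindrifications are those of `B` along the sets of dimensions contained in `I`, and
its substitutions are those of `B` along the transformations that extend a transformation of `I`
by the identity. -/
noncomputable instance instNeatReduct : PolyadicAlgebra I (neatReduct ι B) where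
  cyl Γ x := ⟨cyl (ι '' Γ) x.1, cyl_mem_neatReduct ι _ x.2⟩
  subst τ x := ⟨subst (extendId ι τ) x.1, subst_mem_neatReduct ι τ x.2⟩
  cyl_bot Γ := Subtype.ext (cyl_bot _)
  le_cyl Γ x := le_cyl (ι '' Γ) x.1
  cyl_inf_cyl Γ x y := Subtype.ext (cyl_inf_cyl _ _ _)
  cyl_empty x := Subtype.ext (by simpa using cyl_empty x.1)
  cyl_cyl Γ Δ x := Subtype.ext (by simpa [Set.image_union] using cyl_cyl (ι '' Γ) (ι '' Δ) x.1)
  subst_sup τ x y := Subtype.ext (subst_sup _ _ _)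
  subst_compl τ x := Subtype.ext (subst_compl _ _)
  subst_id x := Subtype.ext (by simpa [extendId_id] using subst_id x.1)
  subst_comp σ τ x := Subtype.ext (by simpa [extendId_comp] using subst_comp _ _ x.1)
  subst_cyl_congr σ τ Γ x h := Subtype.ext (by
    refine subst_cyl_congr _ _ _ _ fun j hj => ?_
    by_cases hr : j ∈ Set.range ι
    · obtain ⟨i, rfl⟩ := hr
      rw [extendId_apply, extendId_apply, h i fun hi => hj ⟨i, hi, rfl⟩]
    · rw [extendId_of_notMem ι _ hr, extendId_of_notMem ι _ hr])
  cyl_subst τ Γ x h := Subtype.ext (by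
    have h1 : Set.InjOn (extendId ι τ) (extendId ι τ ⁻¹' (ι '' Γ)) := by
      rw [extendId_preimage_image]
      rintro _ ⟨a, ha, rfl⟩ _ ⟨b, hb, rfl⟩ hab
      rw [extendId_apply, extendId_apply] at hab
      rw [h ha hb (ι.injective hab)]
    have h2 := cyl_subst (extendId ι τ) (ι '' Γ) x.1 h1
    rwa [extendId_preimage_image] at h2)

end Reduct

section Ordinals

/-- The inclusion `α ⊆ β` of ordinals `α ≤ β`, where an ordinal `α` is identified with the set
`Set.Iio α` of all smaller ordinals. -/
def ordIncl {α β : Ordinal} (h : α ≤ β) : Set.Iio α ↪ Set.Iio β :=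
  Set.embeddingOfSubset _ _ (Set.Iio_subset_Iio h)

/-- `PA α A`: the Boolean algebra `A` carries the structure of a polyadic algebra of
dimension `α`. -/
abbrev PA (α : Ordinal) (A : Type*) [BooleanAlgebra A] := PolyadicAlgebra (Set.Iio α) A

/-- `Nr h B` is the neat `α`-reduct of the polyadic algebra `B` of dimension `β`, for
`h : α ≤ β`. -/
abbrev Nr {α β : Ordinal} (h : α ≤ β) (B : Type*) [BooleanAlgebra B] [PA β B] :
    BooleanSubalgebra B :=
  neatReduct (ordIncl h) B

end Ordinals

end PolyadicAlgebra

namespace PolyadicAlgebra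

section Dilation

universe u

variable {I J : Type u} {ι : I ↪ J} {A B B' : Type*} [BooleanAlgebra A] [BooleanAlgebra B]
  [BooleanAlgebra B'] [PolyadicAlgebra I A] [PolyadicAlgebra J B] [PolyadicAlgebra J B']

/-! Every element of `B` has the form `s_ρ e(a)`, and the isomorphism must send it to `s_ρ e'(a)`.
These pairs form the relation `SubstRel`, which has to be shown functional in both directions and
closed under all operations. Only `ρ` on `I` matters, and, `I` being infinite, any two `ρ, σ` factor
on `I` through one `κ` injective on `I` (`exists_common_factor`). Over such a `κ` everything is
decided in `A`: `a` is recovered from `s_κ e(a)` (`subst_coe_map_injective`), and cylindrifying `s_κ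
e(a)` amounts to cylindrifying `a` (`cyl_subst_coe_map`). -/

theorem coe_map_cyl (e : PolyadicHom I A (neatReduct ι B)) (Γ : Set I) (a : A) :
    (e (cyl Γ a) : B) = cyl (ι '' Γ) (e a : B) :=
  congrArg Subtype.val (e.map_cyl' Γ a)

theorem coe_map_subst (e : PolyadicHom I A (neatReduct ι B)) (τ : I → I) (a : A) :
    (e (subst τ a) : B) = subst (extendId ι τ) (e a : B) :=
  congrArg Subtype.val (e.map_subst' τ a)

theorem coe_map_sup (e : PolyadicHom I A (neatReduct ι B)) (a b : A) :
    (e (a ⊔ b) : B) = (e a : B) ⊔ (e b : B) :=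
  congrArg Subtype.val (e.map_sup' a b)

theorem coe_map_inf (e : PolyadicHom I A (neatReduct ι B)) (a b : A) :
    (e (a ⊓ b) : B) = (e a : B) ⊓ (e b : B) :=
  congrArg Subtype.val (e.map_inf' a b)

theorem coe_map_top (e : PolyadicHom I A (neatReduct ι B)) : (e ⊤ : B) = ⊤ :=
  congrArg Subtype.val e.map_top'

theorem coe_map_bot (e : PolyadicHom I A (neatReduct ι B)) : (e ⊥ : B) = ⊥ :=
  congrArg Subtype.val e.map_bot'

theorem coe_map_compl (e : PolyadicHom I A (neatReduct ι B)) (a : A) :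
    (e aᶜ : B) = (e a : B)ᶜ := by
  refine (IsCompl.compl_eq (isCompl_iff.2 ⟨disjoint_iff.2 ?_, codisjoint_iff.2 ?_⟩)).symm
  · rw [← coe_map_inf, inf_compl_eq_bot, coe_map_bot]
  · rw [← coe_map_sup, sup_compl_eq_top, coe_map_top]

theorem cyl_compl_range_coe_map (e : PolyadicHom I A (neatReduct ι B)) (a : A) :
    cyl (Set.range ι)ᶜ (e a : B) = e a :=
  (e a).2

theorem subst_coe_map_congr (e : PolyadicHom I A (neatReduct ι B)) {ρ σ : J → J}
    (h : ∀ i, ρ (ι i) = σ (ι i)) (a : A) : subst ρ (e a : B) = subst σ (e a : B) := by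
  rw [← cyl_compl_range_coe_map e a]
  refine subst_cyl_congr _ _ _ _ fun j hj => ?_
  obtain ⟨i, rfl⟩ := not_not.1 hj
  exact h i

theorem subst_coe_map_of_factor (e : PolyadicHom I A (neatReduct ι B)) {ρ κ : J → J} {σ : I → I}
    (h : ∀ i, ρ (ι i) = κ (ι (σ i))) (a : A) :
    subst ρ (e a : B) = subst κ (e (subst σ a) : B) := by
  rw [coe_map_subst, ← subst_comp]
  exact subst_coe_map_congr e (fun i => by simp [extendId_apply, h]) a

/-- Dimensions outside `I` are already absorbed: both sides are the cylindrification along `Γ ∪ (J ∖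
I)`. -/
theorem coe_map_cyl_preimage (e : PolyadicHom I A (neatReduct ι B)) (Γ : Set J) (a : A) :
    (e (cyl (ι ⁻¹' Γ) a) : B) = cyl Γ (e a : B) := by
  rw [coe_map_cyl, ← cyl_compl_range_coe_map e a, cyl_cyl, cyl_cyl]
  congr 1
  ext j
  by_cases hj : j ∈ Set.range ι
  · obtain ⟨i, rfl⟩ := hj
    simp
  · simp [hj]

/-! ### Substitutions injective on `I` -/

/-- Two transformations of `J` factor, on a subset `I`, through a common injection of `I`. -/
theorem exists_common_factor [Infinite I] (ι : I ↪ J) (ρ σ : J → J) :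
    ∃ κ : J → J, Function.Injective (κ ∘ ι) ∧ ∃ ρ' σ' : I → I,
      (∀ i, ρ (ι i) = κ (ι (ρ' i))) ∧ ∀ i, σ (ι i) = κ (ι (σ' i)) := by
  -- `κ ∘ ι` will be a bijection of `I` onto `S`; including the range of `ι` forces `S` to have
  -- exactly the cardinality of `I`.
  set S : Set J := Set.range ι ∪ (Set.range (ρ ∘ ι) ∪ Set.range (σ ∘ ι)) with hS
  have hI : Cardinal.aleph0 ≤ Cardinal.mk I := Cardinal.aleph0_le_mk I
  have h1 : Cardinal.mk S ≤ Cardinal.mk I :=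
    (Cardinal.mk_union_le _ _).trans <| Cardinal.add_le_of_le hI Cardinal.mk_range_le <|
      (Cardinal.mk_union_le _ _).trans <|
        Cardinal.add_le_of_le hI Cardinal.mk_range_le Cardinal.mk_range_le
  have h2 : Cardinal.mk I ≤ Cardinal.mk S :=
    Cardinal.mk_le_of_injective (f := fun i => (⟨ι i, Or.inl ⟨i, rfl⟩⟩ : S))
      fun i j h => ι.injective (congrArg Subtype.val h)
  obtain ⟨f⟩ := Cardinal.eq.1 (le_antisymm h2 h1)
  have hf : ∀ i, Function.extend ι (fun i => (f i : J)) id (ι i) = f i :=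
    fun i => ι.injective.extend_apply _ _ _
  refine ⟨Function.extend ι (fun i => (f i : J)) id, fun i j h => ?_,
    fun i => f.symm ⟨ρ (ι i), Or.inr (Or.inl ⟨i, rfl⟩)⟩,
    fun i => f.symm ⟨σ (ι i), Or.inr (Or.inr ⟨i, rfl⟩)⟩, fun i => ?_, fun i => ?_⟩
  · simp only [Function.comp_apply, hf] at h
    exact f.injective (Subtype.ext h)
  · simp [hf]
  · simp [hf]

/-- A left inverse of `κ` on `I` gives a substitution that recovers `e a`. -/
theorem subst_coe_map_injective (e : PolyadicHom I A (neatReduct ι B))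
    (he : Function.Injective e) {κ : J → J} (hκ : Function.Injective (κ ∘ ι)) :
    Function.Injective fun a => subst κ (e a : B) := by
  intro a b h
  have key : ∀ a, subst (Function.extend (κ ∘ ι) ι id) (subst κ (e a : B)) = e a := fun a => by
    rw [← subst_comp, subst_coe_map_congr e (σ := id) (fun i => hκ.extend_apply ι id i) a, subst_id]
  refine he (Subtype.ext ?_)
  rw [← key a, ← key b]
  exact congrArg _ h

/-- Off `I`, `κ` may be replaced by the constant `j₀ ∉ Γ`; the preimage of `Γ` then lies in `I`,
where the map is injective, so `cyl_subst` applies. -/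
theorem cyl_subst_coe_map_of_notMem (e : PolyadicHom I A (neatReduct ι B)) {κ : J → J}
    (hκ : Function.Injective (κ ∘ ι)) {Γ : Set J} {j₀ : J} (hj₀ : j₀ ∉ Γ) (a : A) :
    cyl Γ (subst κ (e a : B)) = subst κ (e (cyl (κ ∘ ι ⁻¹' Γ) a) : B) := by
  have hμ : ∀ i, Function.extend ι (κ ∘ ι) (fun _ => j₀) (ι i) = κ (ι i) :=
    fun i => ι.injective.extend_apply _ _ _
  have hr : ∀ j, j ∉ Set.range ι → Function.extend ι (κ ∘ ι) (fun _ => j₀) j = j₀ :=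
    fun j hj => Function.extend_apply' _ _ _ hj
  set μ := Function.extend ι (κ ∘ ι) (fun _ => j₀)
  have hmem : ∀ j, j ∈ μ ⁻¹' Γ → j ∈ Set.range ι := fun j hj => by
    by_contra h
    exact hj₀ (hr j h ▸ hj)
  have hinj : Set.InjOn μ (μ ⁻¹' Γ) := by
    intro j hj k hk h
    obtain ⟨i, rfl⟩ := hmem j hj
    obtain ⟨i', rfl⟩ := hmem k hk
    rw [hμ, hμ] at h
    rw [hκ h]
  rw [subst_coe_map_congr e (fun i => (hμ i).symm) a,
    subst_coe_map_congr e (fun i => (hμ i).symm), cyl_subst μ Γ _ hinj, ← coe_map_cyl_preimage]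
  congr 4
  ext i
  simp [hμ]

theorem cyl_subst_coe_map [Nontrivial I] (e : PolyadicHom I A (neatReduct ι B)) {κ : J → J}
    (hκ : Function.Injective (κ ∘ ι)) (Γ : Set J) (a : A) :
    cyl Γ (subst κ (e a : B)) = subst κ (e (cyl (κ ∘ ι ⁻¹' Γ) a) : B) := by
  classical
  by_cases hΓ : ∃ j₀, j₀ ∉ Γ
  · obtain ⟨j₀, hj₀⟩ := hΓ
    exact cyl_subst_coe_map_of_notMem e hκ hj₀ a
  -- With `Γ = J` no spare `j₀` exists, so `J` is split into `κ i₀` and the rest. Once everything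
  -- except `i₀` is cylindrified, `κ` may be changed off `i₀` to the value `κ i₁ ≠ κ i₀`, making the
  -- preimage of `κ i₀` a singleton.
  push Not at hΓ
  obtain rfl : Γ = Set.univ := Set.eq_univ_of_forall hΓ
  obtain ⟨i₀, i₁, h01⟩ := exists_pair_ne I
  have hne : κ (ι i₁) ≠ κ (ι i₀) := fun h => h01 (hκ h).symm
  set μ : J → J := fun j => if j = ι i₀ then κ (ι i₀) else κ (ι i₁) with hμ
  have hpre : μ ⁻¹' {κ (ι i₀)} = {ι i₀} := by
    ext j
    by_cases hj : j = ι i₀ <;> simp [hμ, hj, hne]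
  have hpre' : κ ∘ ι ⁻¹' {κ (ι i₀)}ᶜ = ι ⁻¹' {ι i₀}ᶜ := by
    ext i
    simpa using hκ.ne_iff (x := i) (y := i₀)
  have hsplit : (Set.univ : Set J) = {κ (ι i₀)} ∪ {κ (ι i₀)}ᶜ := (Set.union_compl_self _).symm
  have hsplit' : (Set.univ : Set J) = {ι i₀} ∪ {ι i₀}ᶜ := (Set.union_compl_self _).symm
  rw [Set.preimage_univ, ← Set.preimage_univ (f := ι), coe_map_cyl_preimage, hsplit, ← cyl_cyl,
    cyl_subst_coe_map_of_notMem e hκ (j₀ := κ (ι i₀)) (by simp), hpre', coe_map_cyl_preimage,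
    subst_cyl_congr κ μ {ι i₀}ᶜ _ (fun j hj => ?_), cyl_subst μ, hpre, cyl_cyl, ← hsplit, ← hsplit']
  -- After cylindrification along all of `J`, all substitutions agree.
  · exact subst_cyl_congr _ _ _ _ fun j hj => absurd trivial hj
  · rw [hpre]
    exact Set.injOn_singleton _ _
  · obtain rfl : j = ι i₀ := not_not.1 hj
    simp [hμ]

/-! ### The graph of the isomorphism -/

/-- The pairs of elements of two algebras that are obtained by the same substitution from the
images of the same element of `A`. -/
def SubstRel (e : PolyadicHom I A (neatReduct ι B)) (e' : PolyadicHom I A (neatReduct ι B'))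
    (b : B) (b' : B') : Prop :=
  ∃ (ρ : J → J) (a : A), subst ρ (e a : B) = b ∧ subst ρ (e' a : B') = b'

section SubstRel

variable {e : PolyadicHom I A (neatReduct ι B)} {e' : PolyadicHom I A (neatReduct ι B')}
  {b c : B} {b' c' : B'}

theorem substRel_coe_map (e : PolyadicHom I A (neatReduct ι B))
    (e' : PolyadicHom I A (neatReduct ι B')) (a : A) : SubstRel e e' (e a) (e' a) :=
  ⟨id, a, subst_id _, subst_id _⟩

theorem SubstRel.symm (h : SubstRel e e' b b') : SubstRel e' e b' b := by
  obtain ⟨ρ, a, h, h'⟩ := h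
  exact ⟨ρ, a, h', h⟩

theorem SubstRel.exists_common [Infinite I] (h : SubstRel e e' b b') (k : SubstRel e e' c c') :
    ∃ κ : J → J, Function.Injective (κ ∘ ι) ∧ ∃ x y : A,
      (subst κ (e x : B) = b ∧ subst κ (e' x : B') = b') ∧
        subst κ (e y : B) = c ∧ subst κ (e' y : B') = c' := by
  obtain ⟨ρ, x, rfl, rfl⟩ := h
  obtain ⟨σ, y, rfl, rfl⟩ := k
  obtain ⟨κ, hκ, ρ', σ', hρ, hσ⟩ := exists_common_factor ι ρ σ
  exact ⟨κ, hκ, subst ρ' x, subst σ' y,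
    ⟨(subst_coe_map_of_factor e hρ x).symm, (subst_coe_map_of_factor e' hρ x).symm⟩,
    (subst_coe_map_of_factor e hσ y).symm, (subst_coe_map_of_factor e' hσ y).symm⟩

theorem SubstRel.unique [Infinite I] (he : Function.Injective e) (h : SubstRel e e' b b')
    (k : SubstRel e e' b c') : b' = c' := by
  obtain ⟨κ, hκ, x, y, ⟨hx, rfl⟩, hy, rfl⟩ := h.exists_common k
  rw [subst_coe_map_injective e he hκ (hx.trans hy.symm)]

theorem SubstRel.sup [Infinite I] (h : SubstRel e e' b b') (k : SubstRel e e' c c') :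
    SubstRel e e' (b ⊔ c) (b' ⊔ c') := by
  obtain ⟨κ, -, x, y, ⟨rfl, rfl⟩, rfl, rfl⟩ := h.exists_common k
  exact ⟨κ, x ⊔ y, by rw [coe_map_sup, subst_sup], by rw [coe_map_sup, subst_sup]⟩

theorem SubstRel.inf [Infinite I] (h : SubstRel e e' b b') (k : SubstRel e e' c c') :
    SubstRel e e' (b ⊓ c) (b' ⊓ c') := by
  obtain ⟨κ, -, x, y, ⟨rfl, rfl⟩, rfl, rfl⟩ := h.exists_common k
  exact ⟨κ, x ⊓ y, by rw [coe_map_inf, subst_inf], by rw [coe_map_inf, subst_inf]⟩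

theorem SubstRel.compl (h : SubstRel e e' b b') : SubstRel e e' bᶜ b'ᶜ := by
  obtain ⟨ρ, a, rfl, rfl⟩ := h
  exact ⟨ρ, aᶜ, by rw [coe_map_compl, subst_compl], by rw [coe_map_compl, subst_compl]⟩

theorem SubstRel.subst (τ : J → J) (h : SubstRel e e' b b') :
    SubstRel e e' (subst τ b) (subst τ b') := by
  obtain ⟨ρ, a, rfl, rfl⟩ := h
  exact ⟨τ ∘ ρ, a, subst_comp _ _ _, subst_comp _ _ _⟩

theorem SubstRel.cyl [Infinite I] (Γ : Set J) (h : SubstRel e e' b b') :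
    SubstRel e e' (cyl Γ b) (cyl Γ b') := by
  -- Pairing `h` with itself trades an arbitrary `ρ` for a `κ` injective on `I`.
  obtain ⟨κ, hκ, a, -, ⟨rfl, rfl⟩, -⟩ := h.exists_common h
  exact ⟨κ, _, (cyl_subst_coe_map e hκ Γ a).symm, (cyl_subst_coe_map e' hκ Γ a).symm⟩

theorem substRel_top : SubstRel e e' ⊤ ⊤ := by
  simpa only [coe_map_top] using substRel_coe_map e e' ⊤

theorem substRel_bot : SubstRel e e' ⊥ ⊥ := by
  simpa only [coe_map_bot] using substRel_coe_map e e' ⊥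

/-- The domain of the relation is a subuniverse containing the generators. -/
theorem exists_substRel [Infinite I] (e : PolyadicHom I A (neatReduct ι B))
    (e' : PolyadicHom I A (neatReduct ι B'))
    (hgen : Sg J (Set.range fun a => (e a : B)) = Set.univ) (b : B) :
    ∃ b' : B', SubstRel e e' b b' := by
  have hb : b ∈ Sg J (Set.range fun a => (e a : B)) := hgen ▸ Set.mem_univ b
  refine hb {b | ∃ b' : B', SubstRel e e' b b'} ⟨?_, ?_⟩
  · exact
      { bot_mem := ⟨⊥, substRel_bot⟩
        top_mem := ⟨⊤, substRel_top⟩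
        sup_mem := fun _ ⟨_, h⟩ _ ⟨_, k⟩ => ⟨_, h.sup k⟩
        inf_mem := fun _ ⟨_, h⟩ _ ⟨_, k⟩ => ⟨_, h.inf k⟩
        compl_mem := fun _ ⟨_, h⟩ => ⟨_, h.compl⟩
        cyl_mem := fun Γ _ ⟨_, h⟩ => ⟨_, h.cyl Γ⟩
        subst_mem := fun τ _ ⟨_, h⟩ => ⟨_, h.subst τ⟩ }
  · rintro _ ⟨a, rfl⟩
    exact ⟨_, substRel_coe_map e e' a⟩

end SubstRel

/-- Dilations of a polyadic algebra of infinite dimension are unique. -/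
theorem exists_bijective_hom_of_generate [Infinite I] (e : PolyadicHom I A (neatReduct ι B))
    (e' : PolyadicHom I A (neatReduct ι B')) (he : Function.Injective e)
    (he' : Function.Injective e')
    (hgen : Sg J (Set.range fun a => (e a : B)) = Set.univ)
    (hgen' : Sg J (Set.range fun a => (e' a : B')) = Set.univ) :
    ∃ h : PolyadicHom J B B', Function.Bijective h ∧ ∀ a : A, h (e a : B) = (e' a : B') := by
  choose f hf using exists_substRel e e' hgen
  have hf_eq : ∀ {b b'}, SubstRel e e' b b' → f b = b' := fun h => (hf _).unique he h
  refine ⟨{ toFun := f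
            map_sup' := fun b c => hf_eq ((hf b).sup (hf c))
            map_inf' := fun b c => hf_eq ((hf b).inf (hf c))
            map_top' := hf_eq substRel_top
            map_bot' := hf_eq substRel_bot
            map_cyl' := fun Γ b => hf_eq ((hf b).cyl Γ)
            map_subst' := fun τ b => hf_eq ((hf b).subst τ) }, ⟨?_, ?_⟩, ?_⟩
  · intro b c (h : f b = f c)
    exact (hf b).symm.unique he' (h ▸ (hf c).symm)
  · intro b'
    obtain ⟨b, hb⟩ := exists_substRel e' e hgen' b'
    exact ⟨b, hf_eq hb.symm⟩
  · exact fun a => hf_eq (substRel_coe_map e e' a)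

end Dilation

end PolyadicAlgebra

/-! ### Transport along an isomorphism of the small algebras -/

namespace PolyadicHom

/-- Composition of homomorphisms of polyadic algebras. -/
def comp {I A B C : Type*} [BooleanAlgebra A] [BooleanAlgebra B] [BooleanAlgebra C]
    [PolyadicAlgebra I A] [PolyadicAlgebra I B] [PolyadicAlgebra I C]
    (g : PolyadicHom I B C) (f : PolyadicHom I A B) : PolyadicHom I A C where
  toBoundedLatticeHom := g.toBoundedLatticeHom.comp f.toBoundedLatticeHom
  map_cyl' Γ x := (congrArg g.toFun (f.map_cyl' Γ x)).trans (g.map_cyl' Γ _)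
  map_subst' τ x := (congrArg g.toFun (f.map_subst' τ x)).trans (g.map_subst' τ _)

end PolyadicHom

theorem mainTheorem5 {α β : Ordinal} (hα : Ordinal.omega0 ≤ α) (hαβ : α < β)
    {A A' B B' : Type*} [BooleanAlgebra A] [BooleanAlgebra A'] [BooleanAlgebra B]
    [BooleanAlgebra B'] [PolyadicAlgebra.PA α A] [PolyadicAlgebra.PA α A']
    [PolyadicAlgebra.PA β B] [PolyadicAlgebra.PA β B'] :
    (∀ (e : PolyadicHom (Set.Iio α) A (PolyadicAlgebra.Nr hαβ.le B))
        (e' : PolyadicHom (Set.Iio α) A (PolyadicAlgebra.Nr hαβ.le B')),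
        Function.Injective e → Function.Injective e' →
        PolyadicAlgebra.Sg (Set.Iio β) (Set.range fun a => (e a : B)) = Set.univ →
        PolyadicAlgebra.Sg (Set.Iio β) (Set.range fun a => (e' a : B')) = Set.univ →
        ∃ h : PolyadicHom (Set.Iio β) B B', Function.Bijective h ∧
          ∀ a : A, h (e a : B) = (e' a : B')) ∧
    (∀ (e : PolyadicHom (Set.Iio α) A (PolyadicAlgebra.Nr hαβ.le B))
        (e' : PolyadicHom (Set.Iio α) A' (PolyadicAlgebra.Nr hαβ.le B'))
        (i : PolyadicHom (Set.Iio α) A A'),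
        Function.Injective e → Function.Injective e' → Function.Bijective i →
        PolyadicAlgebra.Sg (Set.Iio β) (Set.range fun a => (e a : B)) = Set.univ →
        PolyadicAlgebra.Sg (Set.Iio β) (Set.range fun a => (e' a : B')) = Set.univ →
        ∃ h : PolyadicHom (Set.Iio β) B B', Function.Bijective h ∧
          ∀ a : A, h (e a : B) = (e' (i a) : B')) := by
  have hI : Infinite (Set.Iio α) := by
    rw [Cardinal.infinite_iff, Cardinal.mk_Iio_ordinal, Cardinal.aleph0_le_lift]
    exact Ordinal.aleph0_le_card.2 hα
  refine ⟨fun e e' he he' hgen hgen' =>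
    PolyadicAlgebra.exists_bijective_hom_of_generate e e' he he' hgen hgen',
    -- The second claim is uniqueness for `e` and `e' ∘ i`; surjectivity of `i` keeps the generating
    -- set unchanged.
    fun e e' i he he' hi hgen hgen' =>
    PolyadicAlgebra.exists_bijective_hom_of_generate e (e'.comp i) he (he'.comp hi.1) hgen ?_⟩
  rw [← hgen']
  exact congrArg _ (hi.2.range_comp fun a => (e' a : B'))
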